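/- Let $m \ge 1$ and $n \ge 0$ be integers and $[n]=\{1,\dots,n\}$. The $m$-Catalan arrangement in $\mathbb{R}^n$ is the collection of hyperplanes $x_i-x_j=s$, for $i,j\in[n]$ and $s\in\{0,1,\dots,m\}$. An $m$-Catalan face is a non-empty solution set of a system that prescribes, for each of these hyperplanes, one of $x_i-x_j<s$, $x_i-x_j=s$, $x_i-x_j>s$; its dimension is the dimension of its affine span. An $(m+1)$-ary tree is a finite rooted plane tree in which every vertex has either $m+1$ children (a node) or $0$ children (a leaf). The rank of a non-root vertex is the number of its siblings to its left, so ranks lie in $\{0,\dots,m\}$. The cadet of a node is the rightmost among its children that are nodes and have rank $>0$ (if there is one), and the edge to it is a cadet edge. An $[n]$-decorated $(m+1)$-ary tree is an $(m+1)$-ary tree whose nodes are labeled by non-empty subsets of $[n]$ forming a partition of $[n]$, together with a choice, for each cadet edge, of solid or dashed; all other edges are solid. Trees are considered up to isomorphism. Let $T$ be such a tree. A node is captive if the edge to its parent is dashed, and free otherwise. A leaf is dead if one of its siblings to its left is a captive node; all other vertices are live. For a vertex $v$ let $\rho(v)$ be the word of ranks of the edges on the path from the root to $v$, and let $\dot\rho(v)$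 be the sum of its letters. For $v\ne w$ put $v\prec_T w$ if $\dot\rho(v)<\dot\rho(w)$, or if $\dot\rho(v)=\dot\rho(w)$ and either $\rho(v)$ is a proper prefix of $\rho(w)$ or, at the first index at which they differ, the letter of $\rho(v)$ is larger than that of $\rho(w)$. This is a total order on the vertices; $\preceq_T$ is its reflexive version. Let $\mathrm{nextlive}(v)$ be the $\prec_T$-minimum live vertex that is $\succeq_T v$. For $i\in[n]$ let $v_T(i)$ be the node whose label contains $i$, and let $v_T^s(i)$ be its child of rank $s$. A dashed path from $v$ to $w$ is a path from $v$ to its descendant $w$ all of whose edges are dashed. Theorem. For every $[n]$-decorated $(m+1)$-ary tree $T$ there is a unique $m$-Catalan face in $\mathbb{R}^n$ that consists of all points $p=(p_1,\dots,p_n)$ for which the following three conditions hold: 1. for all $i,j\in[n]$: $p_i\le p_j$ if and only if $v_T(i)\preceq_T v_T(j)$; 2. for all $i,j\in[n]$ and $s\in\{1,\dots,m\}$: $p_i<p_j+s$ if and only if $v_T(i)\prec_T v_T^s(j)$; 3. for all $i,j\in[n]$ and $s\in\{1,\dots,m\}$: $p_i=p_j+s$ if and only if $v_T(i)=\mathrm{nextlive}(v_T^s(j))$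 and there is a dashed path from $v_T(j)$ to $v_T(i)$. Let $\Phi$ denote the map that sends $T$ to this face. Then $\Phi$ is a bijection from the set of $[n]$-decorated $(m+1)$-ary trees to the set of $m$-Catalan faces in $\mathbb{R}^n$. Moreover, for every integer $k\ge 0$, $T$ has exactly $k$ free nodes if and only if $\Phi(T)$ has dimension $k$. -/

import Mathlib

namespace MCatalan

/-! ### Hyperplane arrangements and their faces -/

/-- A face of the arrangement of the hyperplanes `{x | h a x = 0}`: the nonempty solution set of a
system that prescribes, for each hyperplane, equality or one of the two strict inequalities. -/
def IsArrangementFace {ι E : Type*} (h : ι → E → ℝ) (F : Set E) : Prop :=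
  F.Nonempty ∧ ∃ σ : ι → SignType, F = {x | ∀ a, SignType.sign (h a x) = σ a}

/-- The `m`-Catalan arrangement in `ℝ^n`: the hyperplanes `x_i - x_j = s` for all `i, j` and all
`s = 0, 1, …, m`. -/
def mCatalanArrangement (m n : ℕ) (a : Fin n × Fin n × Fin (m + 1)) (x : Fin n → ℝ) : ℝ :=
  x a.1 - x a.2.1 - ((a.2.2 : ℕ) : ℝ)

/-- The type of `m`-Catalan faces in `ℝ^n`. -/
def MCatalanFace (m n : ℕ) : Type :=
  {F : Set (Fin n → ℝ) // IsArrangementFace (mCatalanArrangement m n) F}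

/-- The dimension of a (nonempty) set: the dimension of its affine span. -/
noncomputable def faceDim {n : ℕ} (F : Set (Fin n → ℝ)) : ℕ :=
  Module.finrank ℝ (affineSpan ℝ F).direction

/-! ### Plane trees

A vertex of a plane `(m+1)`-ary tree is identified with the word over `{0, …, m}` that encodes the
path from the root to it: the root is `[]`, and the child of rank `c` of `v` is `v ++ [c]`. -/

/-- Words over `{0, …, m}`. -/
abbrev Word (m : ℕ) : Type := List (Fin (m + 1))

/-- The sum of the letters of a word (with multiplicity). -/
def weight {m : ℕ} (v : Word m) : ℕ := (v.map (fun c => (c : ℕ))).sum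

/-- The strict order `v ≺ w` on vertices. -/
def Prec {m : ℕ} (v w : Word m) : Prop :=
  weight v < weight w ∨
    (weight v = weight w ∧
      ((v <+: w ∧ v ≠ w) ∨
        ∃ (u x y : Word m) (a b : Fin (m + 1)), a < b ∧ v = u ++ b :: x ∧ w = u ++ a :: y))

/-- The weak order `v ⪯ w` on vertices. -/
def PrecEq {m : ℕ} (v w : Word m) : Prop := v = w ∨ Prec v w

/-- A (finite) `(m+1)`-ary tree: a rooted plane tree in which each vertex has either `m+1` or `0`
children. It is given by its finite set of nodes (the vertices that have children), which has to
contain the parent of each of its elements. The empty set of nodes gives the tree with a single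
vertex. -/
@[ext]
structure AryTree (m : ℕ) where
  nodes : Finset (Word m)
  parent_mem : ∀ (v : Word m) (c : Fin (m + 1)), v ++ [c] ∈ nodes → v ∈ nodes

namespace AryTree

variable {m : ℕ} (T : AryTree m)

/-- Vertices: the root, and all children of nodes. -/
def IsVertex (v : Word m) : Prop := v = [] ∨ ∃ u ∈ T.nodes, ∃ c : Fin (m + 1), v = u ++ [c]

/-- Leaves: vertices without children. -/
def IsLeaf (v : Word m) : Prop := T.IsVertex v ∧ v ∉ T.nodes

/-- `u ++ [c]` is the cadet of the node `u`: the rightmost among those children of `u` that have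
rank `> 0` and are nodes. -/
def IsCadet (u : Word m) (c : Fin (m + 1)) : Prop :=
  0 < c ∧ u ++ [c] ∈ T.nodes ∧ ∀ d : Fin (m + 1), c < d → u ++ [d] ∉ T.nodes

end AryTree

/-- An `[n]`-decorated `(m+1)`-ary tree. The set `[n]` is `Fin n`. -/
@[ext]
structure DecoratedTree (m n : ℕ) extends AryTree m where
  /-- The label of a node. -/
  label : Word m → Finset (Fin n)
  label_nonempty : ∀ v ∈ nodes, (label v).Nonempty
  /-- Words that are not nodes carry no label (encoded as the empty set). -/
  label_eq_empty : ∀ v, v ∉ nodes → label v = ∅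
  /-- The labels are pairwise disjoint and cover `[n]`. -/
  label_partition : ∀ i : Fin n, ∃! v : Word m, i ∈ label v
  /-- The dashed edges, each given by its endpoint further from the root. -/
  dashed : Finset (Word m)
  /-- Only cadet edges can be dashed. -/
  dashed_cadet : ∀ v ∈ dashed, ∃ (u : Word m) (c : Fin (m + 1)),
    v = u ++ [c] ∧ toAryTree.IsCadet u c

namespace DecoratedTree

variable {m n : ℕ} (T : DecoratedTree m n)

/-- Captive nodes: nodes connected to their parent by a dashed edge. -/
def IsCaptive (v : Word m) : Prop := v ∈ T.nodes ∧ v ∈ T.dashed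

/-- The finite set of free nodes: the nodes that are not captive. -/
def freeNodes : Finset (Word m) := T.nodes.filter (fun v => v ∉ T.dashed)

/-- Dead leaves: leaves with a captive node among their siblings to the left. -/
def IsDeadLeaf (v : Word m) : Prop :=
  T.IsLeaf v ∧ ∃ (u : Word m) (c d : Fin (m + 1)),
    v = u ++ [c] ∧ d < c ∧ T.IsCaptive (u ++ [d])

/-- Live vertices: vertices that are not dead leaves. -/
def IsLive (v : Word m) : Prop := T.IsVertex v ∧ ¬ T.IsDeadLeaf v

/-- `w` is the vertex `nextlive(v)`: the minimum, in the order `≺`, of the live vertices that are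
greater than or equal to `v`. -/
def IsNextLive (v w : Word m) : Prop :=
  T.IsLive w ∧ PrecEq v w ∧ ∀ u, T.IsLive u → PrecEq v u → PrecEq w u

/-- There is a path of dashed edges from `v` (upwards, away from the root) to `w`. -/
def DashedPath (v w : Word m) : Prop :=
  Relation.ReflTransGen (fun u u' => (∃ c : Fin (m + 1), u' = u ++ [c]) ∧ u' ∈ T.dashed) v w

/-- The unique node whose label contains `i`. -/
noncomputable def nodeOf (i : Fin n) : Word m := (T.label_partition i).exists.choose

theorem mem_label_nodeOf (i : Fin n) : i ∈ T.label (T.nodeOf i) :=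
  (T.label_partition i).exists.choose_spec

/-- The child of rank `s` of the node whose label contains `i`. -/
noncomputable def childOf (i : Fin n) (s : Fin (m + 1)) : Word m := T.nodeOf i ++ [s]

/-- The three conditions on a point `p` of `ℝ^n` that are attached to the decorated tree `T`. -/
structure Valid (p : Fin n → ℝ) : Prop where
  le_iff : ∀ i j : Fin n, p i ≤ p j ↔ PrecEq (T.nodeOf i) (T.nodeOf j)
  lt_iff : ∀ (i j : Fin n) (s : Fin (m + 1)), 0 < s →
    (p i < p j + ((s : ℕ) : ℝ) ↔ Prec (T.nodeOf i) (T.childOf j s))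
  eq_iff : ∀ (i j : Fin n) (s : Fin (m + 1)), 0 < s →
    (p i = p j + ((s : ℕ) : ℝ) ↔
      T.IsNextLive (T.childOf j s) (T.nodeOf i) ∧ T.DashedPath (T.nodeOf j) (T.nodeOf i))

end DecoratedTree

end MCatalan

namespace MCatalan

/-! ### The order on words -/

section Words

variable {m : ℕ}

/-! Read `w ++ [s]` as a placeholder ("slot") for the value `p j + s`, where `w` is the node of `j`;
then `≺` should order slots and nodes as the real numbers are ordered, with ties broken
consistently. Here `≺` is lexicographic: first by weight, then by the depth-first order `Before`,
which visits children from right to left.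

Condition 3 simplifies: along a dashed path the `nextlive` requirement only says that the weights
differ by `s` (`isNextLive_and_dashedPath_iff`). The conditions are then met by an explicit point
whose coordinate at a node has its weight as integer part and, as fractional part, a normalized
count of the free nodes visited so far (`valid_point`). So no tree gives an empty set.

Conversely, a point determines its tree. The node of `i` is the `≺`-largest slot `w ++ [s]` whose
value is at most `p i` and whose `j` satisfies `p j < p i`, a recursion along increasing coordinates
(`nodeOf_eq_nodeAt`, `Valid.unique`). Running this recursion on an arbitrary point gives a tree for
which the point is valid (`valid_treeOfPoint`). As validity depends only on the signs of the
hyperplane functions (`Valid.iff_sign`), trees and faces correspond bijectively.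

For the dimension, dashed paths cut the nodes into chains, each starting at its only free node.
Coordinate differences within a chain are fixed, and the chains can be moved independently by small
amounts, so there is one dimension per free node. -/

@[simp] theorem weight_nil : weight ([] : Word m) = 0 := rfl

@[simp] theorem weight_cons (a : Fin (m + 1)) (v : Word m) :
    weight (a :: v) = (a : ℕ) + weight v := by simp [weight]

@[simp] theorem weight_append (v w : Word m) : weight (v ++ w) = weight v + weight w := by
  simp [weight]

/-- A word with its letters in the dual order. -/
def dualWord (v : Word m) : List (Fin (m + 1))ᵒᵈ := v.map OrderDual.toDual

theorem dualWord_injective : Function.Injective (dualWord (m := m)) :=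
  List.map_injective_iff.2 OrderDual.toDual.injective

/-- The order in which a depth-first search that visits children from right to left
meets the vertices. -/
def Before (v w : Word m) : Prop := dualWord v < dualWord w

@[simp] theorem before_nil_cons (a : Fin (m + 1)) (v : Word m) : Before [] (a :: v) :=
  List.nil_lt_cons _ _

@[simp] theorem not_before_nil (v : Word m) : ¬ Before v [] := List.not_lt_nil _

@[simp] theorem before_cons_cons (a b : Fin (m + 1)) (v w : Word m) :
    Before (a :: v) (b :: w) ↔ b < a ∨ a = b ∧ Before v w := by
  simp [Before, dualWord, List.cons_lt_cons_iff]

theorem Before.trans {u v w : Word m} (h : Before u v) (h' : Before v w) : Before u w :=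
  lt_trans (a := dualWord u) h h'

theorem Before.asymm {v w : Word m} (h : Before v w) : ¬ Before w v :=
  lt_asymm (a := dualWord v) h

@[simp] theorem before_irrefl (v : Word m) : ¬ Before v v := lt_irrefl (dualWord v)

theorem before_trichotomy (v w : Word m) : Before v w ∨ v = w ∨ Before w v := by
  rw [← dualWord_injective.eq_iff]
  exact lt_trichotomy (dualWord v) (dualWord w)

@[simp] theorem before_append_left (u v w : Word m) :
    Before (u ++ v) (u ++ w) ↔ Before v w := by
  induction u with
  | nil => rfl
  | cons a u ih => simp [ih]

@[simp] theorem before_append_self (u v : Word m) : Before u (u ++ v) ↔ v ≠ [] := by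
  conv_lhs => rw [← List.append_nil u, List.append_assoc, List.nil_append]
  rw [before_append_left]
  cases v <;> simp

@[simp] theorem not_append_before_self (u v : Word m) : ¬ Before (u ++ v) u := by
  conv => rw [← List.append_nil u, List.append_assoc, List.nil_append]
  rw [before_append_left]
  simp

/-- At the first index at which `v` and `w` differ, the letter of `v` is larger. -/
def Diverges (v w : Word m) : Prop :=
  ∃ (u x y : Word m) (a b : Fin (m + 1)), a < b ∧ v = u ++ b :: x ∧ w = u ++ a :: y

theorem Diverges.append {v w : Word m} (h : Diverges v w) (x y : Word m) :
    Before (v ++ x) (w ++ y) := by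
  obtain ⟨u, x', y', a, b, hab, rfl, rfl⟩ := h
  simp [hab]

theorem Diverges.append_left {v w : Word m} (h : Diverges v w) (x : Word m) :
    Before (v ++ x) w := by simpa using h.append x []

theorem Diverges.append_right {v w : Word m} (h : Diverges v w) (y : Word m) :
    Before v (w ++ y) := by simpa using h.append [] y

theorem Diverges.before {v w : Word m} (h : Diverges v w) : Before v w := by
  simpa using h.append [] []

theorem Diverges.cons {v w : Word m} (h : Diverges v w) (a : Fin (m + 1)) :
    Diverges (a :: v) (a :: w) := by
  obtain ⟨u, x', y', c, b, hab, rfl, rfl⟩ := h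
  exact ⟨a :: u, x', y', c, b, hab, rfl, rfl⟩

/-- The case split behind most order arguments: a divergence survives appending letters to both
words, so only the two prefix cases need computation. -/
theorem word_cases (v w : Word m) :
    (∃ y, w = v ++ y) ∨ (∃ c y, v = w ++ c :: y) ∨ Diverges v w ∨ Diverges w v := by
  induction v generalizing w with
  | nil => exact .inl ⟨w, rfl⟩
  | cons a v ih =>
    cases w with
    | nil => exact .inr (.inl ⟨a, v, rfl⟩)
    | cons b w =>
      rcases lt_trichotomy a b with h | rfl | h
      · exact .inr (.inr (.inr ⟨[], w, v, a, b, h, rfl, rfl⟩))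
      · rcases ih w with ⟨y, rfl⟩ | ⟨c, y, rfl⟩ | h | h
        · exact .inl ⟨y, rfl⟩
        · exact .inr (.inl ⟨c, y, rfl⟩)
        · exact .inr (.inr (.inl (h.cons a)))
        · exact .inr (.inr (.inr (h.cons a)))
      · exact .inr (.inr (.inl ⟨[], v, w, b, a, h, rfl, rfl⟩))

theorem before_iff (v w : Word m) : Before v w ↔ (v <+: w ∧ v ≠ w) ∨ Diverges v w := by
  constructor
  · intro h
    rcases word_cases v w with ⟨y, rfl⟩ | ⟨c, y, rfl⟩ | h' | h'
    · refine .inl ⟨List.prefix_append _ _, fun h' => ?_⟩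
      rw [← h'] at h
      exact before_irrefl _ h
    · exact absurd h (not_append_before_self _ _)
    · exact .inr h'
    · exact absurd h h'.before.asymm
  · rintro (⟨⟨y, rfl⟩, h⟩ | h)
    · simpa using h
    · exact h.before

theorem prec_iff (v w : Word m) :
    Prec v w ↔ weight v < weight w ∨ weight v = weight w ∧ Before v w := by
  rw [before_iff]
  rfl

/-- The pair that a vertex is compared by in the order `≺`. -/
def sortKey (v : Word m) : ℕ ×ₗ List (Fin (m + 1))ᵒᵈ := toLex (weight v, dualWord v)

theorem sortKey_injective : Function.Injective (sortKey (m := m)) := by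
  intro v w h
  exact dualWord_injective (congrArg (fun x => (ofLex x).2) h)

theorem prec_iff_sortKey (v w : Word m) : Prec v w ↔ sortKey v < sortKey w := by
  rw [prec_iff, sortKey, sortKey, Prod.Lex.toLex_lt_toLex]
  rfl

theorem precEq_iff_sortKey (v w : Word m) : PrecEq v w ↔ sortKey v ≤ sortKey w := by
  rw [PrecEq, prec_iff_sortKey, le_iff_eq_or_lt, sortKey_injective.eq_iff]

theorem Prec.trans {u v w : Word m} (h : Prec u v) (h' : Prec v w) : Prec u w := by
  rw [prec_iff_sortKey] at *
  exact h.trans h'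

theorem PrecEq.trans {u v w : Word m} (h : PrecEq u v) (h' : PrecEq v w) : PrecEq u w := by
  rw [precEq_iff_sortKey] at *
  exact h.trans h'

theorem Prec.trans_precEq {u v w : Word m} (h : Prec u v) (h' : PrecEq v w) : Prec u w := by
  rw [prec_iff_sortKey, precEq_iff_sortKey] at *
  exact h.trans_le h'

theorem PrecEq.refl (v : Word m) : PrecEq v v := .inl rfl

theorem PrecEq.antisymm {v w : Word m} (h : PrecEq v w) (h' : PrecEq w v) : v = w := by
  rw [precEq_iff_sortKey] at *
  exact sortKey_injective (h.antisymm h')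

theorem not_prec {v w : Word m} : ¬ Prec v w ↔ PrecEq w v := by
  rw [prec_iff_sortKey, precEq_iff_sortKey, not_lt]

theorem not_precEq {v w : Word m} : ¬ PrecEq v w ↔ Prec w v := by
  rw [← not_prec, not_not]

theorem prec_irrefl (v : Word m) : ¬ Prec v v := not_prec.2 (.refl v)

theorem Prec.weight_le {v w : Word m} (h : Prec v w) : weight v ≤ weight w := by
  rw [prec_iff] at h
  omega

theorem PrecEq.weight_le {v w : Word m} (h : PrecEq v w) : weight v ≤ weight w := by
  rcases h with rfl | h
  exacts [le_rfl, h.weight_le]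

theorem prec_append (v : Word m) {w : Word m} (h : w ≠ []) : Prec v (v ++ w) := by
  rw [prec_iff]
  simp only [weight_append, before_append_self]
  by_cases h' : weight w = 0
  · exact .inr ⟨by omega, h⟩
  · exact .inl (by omega)

theorem nil_precEq (v : Word m) : PrecEq [] v := by
  by_cases h : v = []
  exacts [.inl h.symm, .inr (prec_append [] h)]

/-! ### Comparison of children in the order `≺` -/

theorem eq_zero_of_weight_cons_eq_zero {y : Word m} {c : Fin (m + 1)} (h : weight (c :: y) = 0) :
    c = 0 := by
  rw [weight_cons] at h
  exact Fin.ext (by rw [Fin.val_zero]; omega)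

/-- The child of rank `0` is the immediate successor. -/
theorem Prec.append_zero {v w : Word m} (h : Prec v w) : PrecEq (v ++ [0]) w := by
  rw [← not_prec]
  intro h'
  rw [prec_iff] at h h'
  simp only [weight_append, weight_cons, weight_nil, Fin.val_zero, add_zero] at h'
  have hw : weight v = weight w := by omega
  have h1 : Before v w := (h.resolve_left (by omega)).2
  have h2 : Before w (v ++ [0]) := (h'.resolve_left (by omega)).2
  rcases word_cases v w with ⟨y, rfl⟩ | ⟨c, y, rfl⟩ | h | h
  · cases y with
    | nil => simp at h1
    | cons c y =>
      have : c = 0 := eq_zero_of_weight_cons_eq_zero (y := y) (by simp at hw ⊢; omega)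
      simp [this] at h2
  · simp at h1
  · exact h2.asymm (h.append_left _)
  · exact h1.asymm h.before

/-- This and the next two lemmas are the tree counterpart of adding the same integer to both sides
of an inequality between coordinates. -/
theorem Prec.append_singleton_of_add {v w : Word m} {c t s : Fin (m + 1)} (hc : 0 < c)
    (hs : (s : ℕ) = c + t) (h : Prec v (w ++ [c])) : Prec (v ++ [t]) (w ++ [s]) := by
  have hc' : 0 < (c : ℕ) := hc
  rw [prec_iff] at *
  simp only [weight_append, weight_cons, weight_nil, add_zero] at *
  rcases h with h | ⟨h, h'⟩
  · omega
  refine .inr ⟨by omega, ?_⟩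
  rcases word_cases v w with ⟨y, rfl⟩ | ⟨b, y, rfl⟩ | h1 | h1
  · simp at h; omega
  · simp at h h' ⊢
    have : (c : ℕ) < b := h'
    omega
  · exact h1.append _ _
  · exact absurd h' (h1.append_left _).asymm

theorem Prec.append_singleton {v w : Word m} {t : Fin (m + 1)} (ht : 0 < t)
    (h : Prec v w) : Prec (v ++ [t]) (w ++ [t]) := by
  rw [prec_iff] at *
  simp only [weight_append, weight_cons, weight_nil, add_zero] at *
  rcases h with h | ⟨h, h'⟩
  · omega
  refine .inr ⟨by omega, ?_⟩
  rcases word_cases v w with ⟨y, rfl⟩ | ⟨b, y, rfl⟩ | h1 | h1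
  · cases y with
    | nil => simp at h'
    | cons b y =>
      have : b = 0 := eq_zero_of_weight_cons_eq_zero (y := y) (by simp at h ⊢; omega)
      simp [this, ht]
  · simp at h'
  · exact h1.append _ _
  · exact absurd h' h1.before.asymm

/-- The conclusion is strict even if `v ++ [c] = w`: the weights then agree, and the search enters
the child of larger rank first. This tie-break forces the parent of a captive node to be the closest
candidate. -/
theorem PrecEq.append_singleton_of_add {v w : Word m} {c t s : Fin (m + 1)} (h0 : 0 < s)
    (ht : (t : ℕ) = c + s) (h : PrecEq (v ++ [c]) w) : Prec (v ++ [t]) (w ++ [s]) := by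
  have hs' : 0 < (s : ℕ) := h0
  have hct : c < t := Fin.lt_def.2 (by omega)
  rcases h with rfl | h
  · rw [prec_iff]
    simp [hct, ht]
  rw [prec_iff] at *
  simp only [weight_append, weight_cons, weight_nil, add_zero] at *
  rcases h with h | ⟨h, h'⟩
  · omega
  refine .inr ⟨by omega, ?_⟩
  rcases word_cases v w with ⟨y, rfl⟩ | ⟨b, y, rfl⟩ | h1 | h1
  · cases y with
    | nil => simp at h'
    | cons b y =>
      have : b < t := by
        simp at h'
        rcases h' with h' | ⟨rfl, h'⟩
        exacts [h'.trans hct, hct]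
      simp [this]
  · simp at h'
  · exact h1.append _ _
  · exact absurd h' (h1.append_right _).asymm

end Words

/-! ### Decorated trees -/

theorem AryTree.mem_nodes_of_append {m : ℕ} (T : AryTree m) {u y : Word m}
    (h : u ++ y ∈ T.nodes) : u ∈ T.nodes := by
  induction y using List.reverseRecOn with
  | nil => simpa using h
  | append_singleton y c ih => exact ih (T.parent_mem _ c (by simpa using h))

theorem AryTree.IsVertex.mem_nodes_of_append {m : ℕ} {T : AryTree m} {u y : Word m}
    (h : T.IsVertex (u ++ y)) (hy : y ≠ []) : u ∈ T.nodes := by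
  rcases h with h | ⟨w, hw, c, h⟩
  · simp [hy] at h
  · obtain ⟨z, d, rfl⟩ := List.eq_nil_or_concat' y |>.resolve_left hy
    rw [← List.append_assoc] at h
    have := (List.append_inj' h rfl).1
    exact T.mem_nodes_of_append (this ▸ hw)

namespace DecoratedTree

variable {m n : ℕ} (T : DecoratedTree m n)

theorem mem_label_iff {i : Fin n} {v : Word m} : i ∈ T.label v ↔ T.nodeOf i = v :=
  ⟨fun h => (T.label_partition i).unique (T.mem_label_nodeOf i) h,
    fun h => h ▸ T.mem_label_nodeOf i⟩

theorem nodeOf_mem (i : Fin n) : T.nodeOf i ∈ T.nodes := by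
  by_contra h
  simpa [T.label_eq_empty _ h] using T.mem_label_nodeOf i

theorem exists_nodeOf_eq {v : Word m} (hv : v ∈ T.nodes) : ∃ i, T.nodeOf i = v := by
  obtain ⟨i, hi⟩ := T.label_nonempty v hv
  exact ⟨i, T.mem_label_iff.1 hi⟩

variable {T}

theorem isCadet_of_dashed {u : Word m} {c : Fin (m + 1)} (h : u ++ [c] ∈ T.dashed) :
    T.IsCadet u c := by
  obtain ⟨u', c', h', hc⟩ := T.dashed_cadet _ h
  obtain ⟨rfl, h''⟩ := List.append_inj' h' rfl
  obtain rfl : c = c' := by simpa using h''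
  exact hc

theorem isLive_of_mem_nodes {v : Word m} (h : v ∈ T.nodes) : T.IsLive v := by
  refine ⟨?_, fun h' => h'.1.2 h⟩
  obtain rfl | ⟨u, c, rfl⟩ := List.eq_nil_or_concat' v
  · exact .inl rfl
  · exact .inr ⟨u, T.parent_mem _ _ h, c, rfl⟩

/-! ### Dashed paths and `nextlive` -/

theorem DashedPath.eq_or_weight_lt {v w : Word m} (h : T.DashedPath v w) :
    v = w ∨ weight v < weight w := by
  induction h with
  | refl => exact .inl rfl
  | tail _ h ih =>
    obtain ⟨⟨c, rfl⟩, h⟩ := h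
    have : 0 < (c : ℕ) := (isCadet_of_dashed h).1
    right
    rcases ih with rfl | ih <;> simp only [weight_append, weight_cons, weight_nil] <;> omega

theorem DashedPath.weight_le {v w : Word m} (h : T.DashedPath v w) : weight v ≤ weight w := by
  rcases h.eq_or_weight_lt with rfl | h
  exacts [le_rfl, h.le]

/-- Above every child of positive rank, there is a live vertex of the same weight. -/
theorem exists_isLive {v : Word m} (hv : v ∈ T.nodes) {s : Fin (m + 1)} (hs : 0 < s) :
    ∃ u, T.IsLive u ∧ PrecEq (v ++ [s]) u ∧ weight u = weight v + s := by
  induction hk : (s : ℕ) using Nat.strong_induction_on generalizing v s with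
  | _ k ih =>
  have hvert : T.IsVertex (v ++ [s]) := .inr ⟨v, hv, s, rfl⟩
  by_cases hd : T.IsDeadLeaf (v ++ [s])
  · obtain ⟨-, u, c, d, h, hdc, hcap⟩ := hd
    obtain ⟨rfl, h'⟩ := List.append_inj' h rfl
    obtain rfl : s = c := by simpa using h'
    have hd0 : 0 < (d : ℕ) := (isCadet_of_dashed hcap.2).1
    have hds : (d : ℕ) < s := hdc
    -- A dead leaf of rank `s` is followed, at the same weight, by the child of rank `s - d` of its
    -- captive sibling of rank `d`; positivity of `d` makes the induction terminate.
    let t : Fin (m + 1) := ⟨s - d, by omega⟩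
    have ht : (t : ℕ) = s - d := rfl
    obtain ⟨w, hw, hle, hwt⟩ := ih (s - d) (by omega) hcap.1 (s := t)
      (Fin.lt_def.2 (by simp [ht]; omega)) rfl
    refine ⟨w, hw, PrecEq.trans (.inr ?_) hle, by rw [hwt]; simp; omega⟩
    rw [prec_iff]
    refine .inr ⟨by simp; omega, by simp [hdc]⟩
  · exact ⟨_, ⟨hvert, hd⟩, .refl _, by simp [hk]⟩

theorem IsNextLive.weight_eq {v w : Word m} (hv : v ∈ T.nodes) {s : Fin (m + 1)} (hs : 0 < s)
    (h : T.IsNextLive (v ++ [s]) w) : weight w = weight v + s := by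
  obtain ⟨u, hu, hle, hwt⟩ := exists_isLive hv hs
  have h1 := h.2.1.weight_le
  have h2 := (h.2.2 u hu hle).weight_le
  simp at h1
  omega

theorem isNextLive_of_mem_nodes {v : Word m} (h : v ∈ T.nodes) : T.IsNextLive v v :=
  ⟨isLive_of_mem_nodes h, .refl _, fun _ _ h => h⟩

/-- If the first dashed edge has rank `d < s`, then `v ++ [s]` lies to the right of the cadet, so it
is a dead leaf. No live vertex lies strictly between it and the child of rank `s - d` of the cadet,
so `nextlive` passes along the path. -/
theorem DashedPath.isNextLive {v w : Word m} (h : T.DashedPath v w) {s : Fin (m + 1)}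
    (hs : 0 < s) (hw : weight w = weight v + s) : T.IsNextLive (v ++ [s]) w := by
  have hs' : 0 < (s : ℕ) := hs
  induction h using Relation.ReflTransGen.head_induction_on generalizing s with
  | refl => omega
  | head h hp ih =>
    rename_i v v'
    obtain ⟨⟨d, rfl⟩, hd⟩ := h
    have hcad := isCadet_of_dashed hd
    have hd0 : 0 < (d : ℕ) := hcad.1
    have hwt := DashedPath.weight_le hp
    simp at hwt
    rcases DashedPath.eq_or_weight_lt hp with rfl | hlt
    · obtain rfl : s = d := Fin.ext (by simp at hw; omega)
      exact isNextLive_of_mem_nodes hcad.2.1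
    simp only [weight_append, weight_cons, weight_nil, add_zero] at hlt
    have hds : d < s := Fin.lt_def.2 (by omega)
    let t : Fin (m + 1) := ⟨s - d, by omega⟩
    have ht : (t : ℕ) = s - d := rfl
    have ht0 : 0 < (t : ℕ) := by omega
    have hnext := ih (s := t) ht0 (by simp; omega) ht0
    refine ⟨hnext.1, PrecEq.trans (.inr ?_) hnext.2.1, fun u hu hle => ?_⟩
    · rw [prec_iff]
      exact .inr ⟨by simp; omega, by simp [hds]⟩
    refine hnext.2.2 u hu ?_
    by_contra hlt'
    rw [not_precEq] at hlt'
    have h1 := hle.weight_le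
    have h2 := hlt'.weight_le
    simp at h1 h2
    have hv : v ∈ T.nodes := T.parent_mem _ _ hcad.2.1
    have hsn : v ++ [s] ∉ T.nodes := hcad.2.2 s hds
    have hne : v ++ [s] ≠ u := by
      rintro rfl
      exact hu.2 ⟨⟨hu.1, hsn⟩, v, s, d, rfl, hds, hcad.2.1, hd⟩
    have hB := ((prec_iff _ _).1 (hle.resolve_left hne)).resolve_left (by simp; omega) |>.2
    have hB' := ((prec_iff _ _).1 hlt').resolve_left (by simp; omega) |>.2
    -- A live `u` in the gap has the same weight and must extend `v`. If it is a child of `v`, it is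
    -- `v ++ [s]` itself; otherwise its branch contains a node child of `v` beyond the cadet, or
    -- enters the cadet with a rank exceeding the available weight.
    rcases word_cases v u with ⟨y, rfl⟩ | ⟨b, y, rfl⟩ | h3 | h3
    · cases y with
      | nil => simp at hB
      | cons a y =>
        by_cases hy : y = []
        · subst hy
          apply hne
          congr
          simp at h1 h2
          exact Fin.ext (by omega)
        have hva : v ++ [a] ∈ T.nodes := by
          refine AryTree.IsVertex.mem_nodes_of_append (y := y) ?_ hy
          simpa using hu.1
        simp at hB hB' h1 h2
        rcases hB' with hda | ⟨rfl, hB'⟩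
        · exact hcad.2.2 _ hda hva
        · cases y with
          | nil => simp at hy
          | cons b y =>
            simp at hB' h1 h2
            have : (t : ℕ) < b := hB'
            omega
    · simp at hB
    · exact (h3.append_left _).asymm (by simpa using hB')
    · exact (h3.append_right _).asymm hB

/-- The condition on `nextlive` in the presence of a dashed path. -/
theorem isNextLive_and_dashedPath_iff {v w : Word m} (hv : v ∈ T.nodes) {s : Fin (m + 1)}
    (hs : 0 < s) :
    T.IsNextLive (v ++ [s]) w ∧ T.DashedPath v w ↔
      weight w = weight v + s ∧ T.DashedPath v w :=
  ⟨fun h => ⟨h.1.weight_eq hv hs, h.2⟩, fun h => ⟨h.2.isNextLive hs h.1, h.2⟩⟩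

theorem valid_iff {p : Fin n → ℝ} : T.Valid p ↔
    (∀ i j, p i ≤ p j ↔ PrecEq (T.nodeOf i) (T.nodeOf j)) ∧
    (∀ (i j : Fin n) (s : Fin (m + 1)), 0 < s →
      (p i < p j + ((s : ℕ) : ℝ) ↔ Prec (T.nodeOf i) (T.childOf j s))) ∧
    (∀ (i j : Fin n) (s : Fin (m + 1)), 0 < s →
      (p i = p j + ((s : ℕ) : ℝ) ↔ weight (T.nodeOf i) = weight (T.nodeOf j) + s ∧
        T.DashedPath (T.nodeOf j) (T.nodeOf i))) := by
  refine ⟨fun h => ⟨h.le_iff, h.lt_iff, fun i j s hs => ?_⟩,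
    fun h => ⟨h.1, h.2.1, fun i j s hs => ?_⟩⟩
  · rw [h.eq_iff i j s hs]
    exact isNextLive_and_dashedPath_iff (T.nodeOf_mem j) hs
  · rw [h.2.2 i j s hs]
    exact (isNextLive_and_dashedPath_iff (T.nodeOf_mem j) hs).symm

/-! ### A point in the face of a tree -/

instance (v w : Word m) : Decidable (Before v w) :=
  inferInstanceAs (Decidable (dualWord v < dualWord w))

/-- The number of free nodes that are met not later than `v` in the depth-first order. -/
def freeCount (T : DecoratedTree m n) (v : Word m) : ℕ :=
  (T.freeNodes.filter (fun u => ¬ Before v u)).card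

theorem freeCount_mono {v w : Word m} (h : Before v w) : T.freeCount v ≤ T.freeCount w := by
  refine Finset.card_le_card fun u hu => ?_
  rw [Finset.mem_filter] at *
  exact ⟨hu.1, fun h' => hu.2 (h.trans h')⟩

theorem freeCount_le (v : Word m) : T.freeCount v ≤ T.freeNodes.card :=
  Finset.card_filter_le _ _

/-- A captive node comes immediately after its parent in the depth-first order. -/
theorem eq_or_before_of_before_dashed {u x : Word m} {d : Fin (m + 1)} (hd : u ++ [d] ∈ T.dashed)
    (hx : x ∈ T.nodes) (h : Before x (u ++ [d])) : x = u ∨ Before x u := by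
  have hcad := isCadet_of_dashed hd
  rcases word_cases u x with ⟨y, rfl⟩ | ⟨b, y, rfl⟩ | h3 | h3
  · cases y with
    | nil => simp
    | cons b y =>
      have : d < b := by simpa using h
      refine absurd (T.mem_nodes_of_append (u := u ++ [b]) (y := y) (by simpa using hx))
        (hcad.2.2 b this)
  · simp
  · exact absurd h (h3.append_left _).asymm
  · exact .inr h3.before

/-- A captive node directly follows its parent in the search and is not itself counted. -/
theorem DashedPath.freeCount_eq {v w : Word m} (h : T.DashedPath v w) :
    T.freeCount v = T.freeCount w := by
  induction h with
  | refl => rfl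
  | tail _ h ih =>
    obtain ⟨⟨d, rfl⟩, hd⟩ := h
    rename_i u _
    rw [ih]
    refine (freeCount_mono (by simp)).antisymm (Finset.card_le_card fun x hx => ?_)
    simp only [freeNodes, Finset.mem_filter] at *
    refine ⟨hx.1, fun hux => ?_⟩
    rcases before_trichotomy x (u ++ [d]) with h | rfl | h
    · rcases eq_or_before_of_before_dashed hd hx.1.1 h with rfl | h
      · simp at hux
      · exact hux.asymm h
    · exact hx.1.2 hd
    · exact hx.2 h

/-- If `w` is free it is counted itself. If it is captive, its parent is its immediate predecessor
and has the same count, so the claim passes to the parent. -/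
theorem freeCount_lt_or_dashedPath {v w : Word m} (hv : v ∈ T.nodes) (hw : w ∈ T.nodes)
    (h : Before v w) : T.freeCount v < T.freeCount w ∨ T.DashedPath v w := by
  induction w using List.reverseRecOn with
  | nil => simp at h
  | append_singleton u d ih =>
    by_cases hd : u ++ [d] ∈ T.dashed
    · have hpath : T.DashedPath u (u ++ [d]) := .single ⟨⟨d, rfl⟩, hd⟩
      rcases eq_or_before_of_before_dashed hd hv h with rfl | h
      · exact .inr hpath
      · rcases ih (T.parent_mem _ _ hw) h with h | h
        · exact .inl (hpath.freeCount_eq ▸ h)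
        · exact .inr (Relation.ReflTransGen.trans h hpath)
    · refine .inl (Finset.card_lt_card ?_)
      rw [Finset.ssubset_iff_of_subset]
      · refine ⟨u ++ [d], ?_, ?_⟩ <;> simp [freeNodes, hw, hd, h]
      · intro x hx
        rw [Finset.mem_filter] at *
        exact ⟨hx.1, fun h' => hx.2 (h.trans h')⟩

/-- The fractional part of the coordinates at `v` of the point `T.point`. -/
noncomputable def fracPart (T : DecoratedTree m n) (v : Word m) : ℝ :=
  -- The `+ 1` keeps the quotient below 1.
  T.freeCount v / (T.freeNodes.card + 1)

/-- A point in the face of `T`. -/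
noncomputable def point (T : DecoratedTree m n) (i : Fin n) : ℝ :=
  weight (T.nodeOf i) + T.fracPart (T.nodeOf i)

theorem fracPart_nonneg (v : Word m) : 0 ≤ T.fracPart v := by
  unfold fracPart
  positivity

theorem fracPart_lt_one (v : Word m) : T.fracPart v < 1 := by
  unfold fracPart
  rw [div_lt_one (by positivity)]
  exact_mod_cast Nat.lt_succ_of_le (freeCount_le v)

theorem fracPart_lt_iff {v w : Word m} :
    T.fracPart v < T.fracPart w ↔ T.freeCount v < T.freeCount w := by
  unfold fracPart
  rw [div_lt_div_iff_of_pos_right (by positivity)]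
  exact_mod_cast Iff.rfl

theorem fracPart_inj {v w : Word m} :
    T.fracPart v = T.fracPart w ↔ T.freeCount v = T.freeCount w := by
  unfold fracPart
  rw [div_left_inj' (by positivity)]
  exact_mod_cast Iff.rfl

theorem add_lt_add_iff_of_fract {a b : ℕ} {x y : ℝ} (hx : 0 ≤ x) (hx' : x < 1) (hy : 0 ≤ y)
    (hy' : y < 1) : (a : ℝ) + x < b + y ↔ a < b ∨ a = b ∧ x < y := by
  rcases lt_trichotomy a b with h | rfl | h
  · have : (a : ℝ) + 1 ≤ b := by exact_mod_cast h
    simp only [h, true_or, iff_true]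
    linarith
  · simp
  · have : (b : ℝ) + 1 ≤ a := by exact_mod_cast h
    simp only [h.not_gt, h.ne', false_and, or_self, iff_false]
    linarith

theorem add_eq_add_iff_of_fract {a b : ℕ} {x y : ℝ} (hx : 0 ≤ x) (hx' : x < 1) (hy : 0 ≤ y)
    (hy' : y < 1) : (a : ℝ) + x = b + y ↔ a = b ∧ x = y := by
  refine ⟨fun h => ?_, fun h => by rw [h.1, h.2]⟩
  have h1 := (add_lt_add_iff_of_fract (a := a) (b := b) hx hx' hy hy').not.1 h.not_lt
  have h2 := (add_lt_add_iff_of_fract (a := b) (b := a) hy hy' hx hx').not.1 h.not_gt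
  obtain rfl : a = b := by omega
  simpa using h

theorem point_lt_iff (i j : Fin n) :
    T.point i < T.point j ↔ Prec (T.nodeOf i) (T.nodeOf j) := by
  rw [point, point, add_lt_add_iff_of_fract (fracPart_nonneg _) (fracPart_lt_one _)
    (fracPart_nonneg _) (fracPart_lt_one _), prec_iff, fracPart_lt_iff]
  refine or_congr_right (and_congr_right fun hw => ⟨fun h => ?_, fun h => ?_⟩)
  · rcases before_trichotomy (T.nodeOf i) (T.nodeOf j) with h' | h' | h'
    · exact h'
    · simp [h'] at h
    · exact absurd (freeCount_mono h') h.not_ge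
  · refine (freeCount_lt_or_dashedPath (T.nodeOf_mem i) (T.nodeOf_mem j) h).resolve_right
      fun h' => ?_
    rcases h'.eq_or_weight_lt with h' | h'
    · simp [h'] at h
    · omega

/-- Comparing coordinates after integer shifts is lexicographic in weight and free count. At weights
differing by exactly `s > 0`, the free count separates two nodes unless a dashed path joins them,
and weights force that path to run upwards to `i`. -/
theorem valid_point (T : DecoratedTree m n) : T.Valid T.point := by
  rw [valid_iff]
  refine ⟨fun i j => ?_, fun i j s hs => ?_, fun i j s hs => ?_⟩
  · rw [← not_lt, point_lt_iff, not_prec]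
  all_goals
    have hs' : 0 < (s : ℕ) := hs
    have hpt : T.point j + ((s : ℕ) : ℝ) =
        ((weight (T.nodeOf j) + s : ℕ) : ℝ) + T.fracPart (T.nodeOf j) := by
      rw [point]
      push_cast
      ring
  · rw [hpt, point, add_lt_add_iff_of_fract (fracPart_nonneg _) (fracPart_lt_one _)
      (fracPart_nonneg _) (fracPart_lt_one _), prec_iff, fracPart_lt_iff, childOf]
    simp only [weight_append, weight_cons, weight_nil, add_zero]
    refine or_congr_right (and_congr_right fun hw => ⟨fun h => ?_, fun h => ?_⟩)
    · rcases before_trichotomy (T.nodeOf i) (T.nodeOf j) with h' | h' | h'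
      · exact h'.trans (by simp)
      · simp [h'] at h
      · exact absurd (freeCount_mono h') h.not_ge
    · have hB : Before (T.nodeOf i) (T.nodeOf j) := by
        rcases word_cases (T.nodeOf i) (T.nodeOf j) with ⟨y, h'⟩ | ⟨b, y, h'⟩ | h' | h'
        · rw [h'] at hw
          simp at hw
          omega
        · rw [h'] at h hw
          have h1 : (s : ℕ) < b := by simpa using h
          simp at hw
          omega
        · exact h'.before
        · exact absurd h (h'.append_left _).asymm
      refine (freeCount_lt_or_dashedPath (T.nodeOf_mem i) (T.nodeOf_mem j) hB).resolve_right
        fun h' => ?_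
      have := h'.weight_le
      omega
  · rw [hpt, point, add_eq_add_iff_of_fract (fracPart_nonneg _) (fracPart_lt_one _)
      (fracPart_nonneg _) (fracPart_lt_one _), fracPart_inj]
    refine and_congr_right fun hw => ⟨fun h => ?_, fun h => h.freeCount_eq.symm⟩
    rcases before_trichotomy (T.nodeOf j) (T.nodeOf i) with h' | h' | h'
    · exact (freeCount_lt_or_dashedPath (T.nodeOf_mem j) (T.nodeOf_mem i) h').resolve_left
        (by omega)
    · rw [h'] at hw
      omega
    · refine absurd ((freeCount_lt_or_dashedPath (T.nodeOf_mem i) (T.nodeOf_mem j) h').resolve_left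
        (by omega)).weight_le (by omega)

end DecoratedTree

/-! ### The nodes as maximal slots -/

section Slots

variable {m n : ℕ}

open Classical in
/-- The maximum of a set of words, or `[]` if there is none. -/
noncomputable def maxWord (S : Set (Word m)) : Word m :=
  -- The default is the root, as needed for the smallest coordinates, which have no slots.
  if h : ∃ w ∈ S, ∀ w' ∈ S, PrecEq w' w then h.choose else []

theorem maxWord_eq {S : Set (Word m)} {w : Word m} (hw : w ∈ S) (h : ∀ w' ∈ S, PrecEq w' w) :
    maxWord S = w := by
  have hex : ∃ w ∈ S, ∀ w' ∈ S, PrecEq w' w := ⟨w, hw, h⟩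
  rw [maxWord, dif_pos hex]
  exact (h _ hex.choose_spec.1).antisymm (hex.choose_spec.2 w hw)

theorem maxWord_of_forall_notMem {S : Set (Word m)} (h : ∀ w, w ∉ S) : maxWord S = [] :=
  dif_neg fun ⟨w, hw, _⟩ => h w hw

theorem maxWord_spec {S : Set (Word m)} (hS : S.Finite) (hne : S.Nonempty) :
    maxWord S ∈ S ∧ ∀ w ∈ S, PrecEq w (maxWord S) := by
  obtain ⟨w, hw, h⟩ := Set.exists_max_image S sortKey hS hne
  have h' : ∀ w' ∈ S, PrecEq w' w := fun w' hw' => (precEq_iff_sortKey _ _).2 (h w' hw')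
  rw [maxWord_eq hw h']
  exact ⟨hw, h'⟩

/-- If the coordinate `j` of `p` is at the node `v j`, then these are the vertices that come
not later than the node of `i`. -/
def slots (p : Fin n → ℝ) (v : Fin n → Word m) (i : Fin n) : Set (Word m) :=
  {w | ∃ (j : Fin n) (s : Fin (m + 1)), p j < p i ∧ p j + ((s : ℕ) : ℝ) ≤ p i ∧ w = v j ++ [s]}

theorem slots_finite (p : Fin n → ℝ) (v : Fin n → Word m) (i : Fin n) : (slots p v i).Finite := by
  refine (Set.finite_range fun x : Fin n × Fin (m + 1) => v x.1 ++ [x.2]).subset ?_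
  rintro w ⟨j, s, -, -, rfl⟩
  exact ⟨(j, s), rfl⟩

theorem wellFounded_coord_lt (p : Fin n → ℝ) : WellFounded fun i j => p i < p j := by
  have : IsTrans (Fin n) fun i j => p i < p j := ⟨fun _ _ _ => lt_trans⟩
  have : Std.Irrefl fun i j : Fin n => p i < p j := ⟨fun _ => lt_irrefl _⟩
  exact Finite.wellFounded_of_trans_of_irrefl _

/-- The node of a coordinate of `p`. -/
noncomputable def nodeAt (m : ℕ) (p : Fin n → ℝ) : Fin n → Word m :=
  (wellFounded_coord_lt p).fix fun i ih =>
    maxWord {w | ∃ (j : Fin n) (s : Fin (m + 1)) (h : p j < p i),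
      p j + ((s : ℕ) : ℝ) ≤ p i ∧ w = ih j h ++ [s]}

theorem nodeAt_eq (p : Fin n → ℝ) (i : Fin n) :
    nodeAt m p i = maxWord (slots p (nodeAt m p) i) := by
  rw [nodeAt, WellFounded.fix_eq]
  simp only [slots, exists_prop]

/-- The slots of `i` involve `v` only at smaller coordinates, so the recursion has a unique
solution. -/
theorem eq_nodeAt {p : Fin n → ℝ} {v : Fin n → Word m} (h : ∀ i, v i = maxWord (slots p v i)) :
    v = nodeAt m p := by
  funext i
  induction i using (wellFounded_coord_lt p).induction with
  | _ i ih =>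
  rw [h i, nodeAt_eq]
  congr 1
  ext w
  refine exists_congr fun j => exists_congr fun s => and_congr_right fun hj => ?_
  rw [ih j hj]

end Slots

/-! ### The tree is determined by a point of its face -/

namespace DecoratedTree

variable {m n : ℕ} {T : DecoratedTree m n} {p : Fin n → ℝ}

theorem Valid.coord_lt_iff (h : T.Valid p) (i j : Fin n) :
    p i < p j ↔ Prec (T.nodeOf i) (T.nodeOf j) := by
  rw [← not_le, h.le_iff, not_precEq]

/-- The node of `i` is itself a slot, namely a child of its parent. Validity places every other slot
of `i` not later; for rank 0 this holds because the child of rank 0 is the immediate successor. -/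
theorem Valid.nodeOf_eq_nodeAt (h : T.Valid p) : T.nodeOf = nodeAt m p := by
  refine eq_nodeAt fun i => ?_
  obtain hi | ⟨u, c, hi⟩ := List.eq_nil_or_concat' (T.nodeOf i)
  · rw [maxWord_of_forall_notMem, hi]
    rintro w ⟨j, s, hj, -⟩
    rw [h.coord_lt_iff, hi] at hj
    exact not_prec.2 (nil_precEq _) hj
  · obtain ⟨j, rfl⟩ := T.exists_nodeOf_eq (T.parent_mem u c (hi ▸ T.nodeOf_mem i))
    have hji : p j < p i := by
      rw [h.coord_lt_iff, hi]
      exact prec_append _ (by simp)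
    have hmem : p j + ((c : ℕ) : ℝ) ≤ p i := by
      by_cases hc : c = 0
      · simpa [hc] using hji.le
      · rw [← not_lt, h.lt_iff i j c (Fin.pos_iff_ne_zero.2 hc), childOf, hi]
        exact prec_irrefl _
    refine (maxWord_eq (S := slots p T.nodeOf i) ⟨j, c, hji, hmem, hi⟩ ?_).symm
    rintro w ⟨k, s, hk, hks, rfl⟩
    by_cases hs : s = 0
    · rw [hs]
      exact ((h.coord_lt_iff k i).1 hk).append_zero
    · rw [← not_prec]
      rwa [← not_lt, h.lt_iff i k s (Fin.pos_iff_ne_zero.2 hs)] at hks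

theorem DashedPath.mem_dashed {u : Word m} {c : Fin (m + 1)} (h : T.DashedPath u (u ++ [c])) :
    u ++ [c] ∈ T.dashed := by
  rcases Relation.ReflTransGen.cases_tail h with h | ⟨w, -, h⟩
  · simp at h
  · exact h.2

theorem Valid.mem_dashed_iff (h : T.Valid p) (w : Word m) : w ∈ T.dashed ↔
    ∃ (i j : Fin n) (s : Fin (m + 1)), 0 < s ∧ w = T.nodeOf i ∧ T.nodeOf i = T.nodeOf j ++ [s] ∧
      p i = p j + ((s : ℕ) : ℝ) := by
  constructor
  · intro hw
    obtain ⟨u, s, rfl, hc⟩ := T.dashed_cadet w hw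
    obtain ⟨i, hi⟩ := T.exists_nodeOf_eq hc.2.1
    obtain ⟨j, rfl⟩ := T.exists_nodeOf_eq (T.parent_mem _ _ hc.2.1)
    refine ⟨i, j, s, hc.1, hi.symm, hi, ?_⟩
    rw [(valid_iff.1 h).2.2 i j s hc.1, hi]
    exact ⟨by simp, .single ⟨⟨s, rfl⟩, hw⟩⟩
  · rintro ⟨i, j, s, hs, rfl, hi, hp⟩
    rw [(valid_iff.1 h).2.2 i j s hs] at hp
    rw [hi] at hp ⊢
    exact hp.2.mem_dashed

theorem mem_nodes_iff {w : Word m} : w ∈ T.nodes ↔ ∃ i, T.nodeOf i = w :=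
  ⟨T.exists_nodeOf_eq, fun ⟨i, h⟩ => h ▸ T.nodeOf_mem i⟩

theorem Valid.unique {T' : DecoratedTree m n} (h : T.Valid p) (h' : T'.Valid p) : T = T' := by
  have hn : T.nodeOf = T'.nodeOf := h.nodeOf_eq_nodeAt.trans h'.nodeOf_eq_nodeAt.symm
  refine DecoratedTree.ext ?_ ?_ ?_
  · ext w
    rw [mem_nodes_iff, mem_nodes_iff, hn]
  · funext w
    ext i
    rw [mem_label_iff, mem_label_iff, hn]
  · ext w
    rw [h.mem_dashed_iff, h'.mem_dashed_iff, hn]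

end DecoratedTree

/-! ### The tree of a point -/

section TreeOfPoint

variable {m n : ℕ} (p : Fin n → ℝ)

theorem precEq_nodeAt_of_mem_slots {i : Fin n} {w : Word m} (hw : w ∈ slots p (nodeAt m p) i) :
    PrecEq w (nodeAt m p i) := by
  rw [nodeAt_eq p i]
  exact (maxWord_spec (slots_finite _ _ _) ⟨w, hw⟩).2 w hw

theorem nodeAt_eq_nil_or (i : Fin n) : nodeAt m p i = [] ∨
    ∃ (j : Fin n) (s : Fin (m + 1)), p j < p i ∧ p j + ((s : ℕ) : ℝ) ≤ p i ∧
      nodeAt m p i = nodeAt m p j ++ [s] := by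
  rcases (slots p (nodeAt m p) i).eq_empty_or_nonempty with h | h
  · left
    rw [nodeAt_eq, h]
    exact maxWord_of_forall_notMem fun _ => Set.notMem_empty _
  · right
    rw [nodeAt_eq]
    exact (maxWord_spec (slots_finite _ _ _) h).1

variable {p}

theorem nodeAt_prec {i j : Fin n} (h : p i < p j) : Prec (nodeAt m p i) (nodeAt m p j) :=
  (prec_append _ (by simp)).trans_precEq
    (precEq_nodeAt_of_mem_slots p ⟨i, 0, h, by simpa using h.le, rfl⟩)

theorem nodeAt_congr {i j : Fin n} (h : p i = p j) : nodeAt m p i = nodeAt m p j := by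
  rw [nodeAt_eq, nodeAt_eq p j, slots, slots, h]

theorem nodeAt_prec_iff {i j : Fin n} : Prec (nodeAt m p i) (nodeAt m p j) ↔ p i < p j := by
  refine ⟨fun h => ?_, nodeAt_prec⟩
  by_contra h'
  rcases (not_lt.1 h').eq_or_lt with h' | h'
  · rw [nodeAt_congr h'] at h
    exact prec_irrefl _ h
  · exact prec_irrefl _ (h.trans (nodeAt_prec h'))

theorem nodeAt_precEq_iff {i j : Fin n} : PrecEq (nodeAt m p i) (nodeAt m p j) ↔ p i ≤ p j := by
  rw [← not_prec, nodeAt_prec_iff, not_lt]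

theorem nodeAt_inj {i j : Fin n} : nodeAt m p i = nodeAt m p j ↔ p i = p j := by
  refine ⟨fun h => ?_, nodeAt_congr⟩
  exact (nodeAt_precEq_iff.1 (.inl h)).antisymm (nodeAt_precEq_iff.1 (.inl h.symm))

theorem append_precEq_nodeAt {i j : Fin n} {s : Fin (m + 1)} (hs : 0 < s)
    (h : p j + ((s : ℕ) : ℝ) ≤ p i) : PrecEq (nodeAt m p j ++ [s]) (nodeAt m p i) := by
  have : (0 : ℝ) < ((s : ℕ) : ℝ) := by exact_mod_cast hs
  exact precEq_nodeAt_of_mem_slots p ⟨j, s, by linarith, h, rfl⟩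

/-- If slots of positive rank are compared with other such slots correctly after lowering the
ranks, then they are compared correctly. -/
theorem append_prec_append_of_lt {j k : Fin n} {s t : Fin (m + 1)} (hs : 0 < s) (ht : 0 < t)
    (h : p k + ((t : ℕ) : ℝ) < p j + ((s : ℕ) : ℝ))
    (ih : ∀ c : Fin (m + 1), 0 < c → p k < p j + ((c : ℕ) : ℝ) →
      Prec (nodeAt m p k) (nodeAt m p j ++ [c])) :
    Prec (nodeAt m p k ++ [t]) (nodeAt m p j ++ [s]) := by
  have hs' : 0 < (s : ℕ) := hs
  have ht' : 0 < (t : ℕ) := ht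
  -- Subtracting the smaller rank from both sides leaves a comparison of a node with a slot or of
  -- two nodes.
  rcases lt_trichotomy s t with hst | rfl | hst
  · have hst' : (s : ℕ) < t := hst
    let c : Fin (m + 1) := ⟨t - s, by omega⟩
    have hc : (t : ℕ) = c + s := (Nat.sub_add_cancel hst'.le).symm
    have hc0 : 0 < (c : ℕ) := by omega
    refine PrecEq.append_singleton_of_add hs hc (append_precEq_nodeAt hc0 ?_)
    rw [hc] at h
    push_cast at h
    linarith
  · exact (nodeAt_prec (by linarith)).append_singleton hs
  · have hst' : (t : ℕ) < s := hst
    let c : Fin (m + 1) := ⟨s - t, by omega⟩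
    have hc : (s : ℕ) = c + t := (Nat.sub_add_cancel hst'.le).symm
    have hc0 : 0 < (c : ℕ) := by omega
    refine Prec.append_singleton_of_add hc0 hc (ih c hc0 ?_)
    rw [hc] at h
    push_cast at h
    linarith

/-- Induction on `p i`: the node of `i` is a slot of a smaller coordinate `k` with value at most `p
i`, hence below `p j + s`; the comparison of slots reduces to one of `k` with `j`. -/
theorem nodeAt_prec_append {i j : Fin n} {s : Fin (m + 1)} (hs : 0 < s)
    (h : p i < p j + ((s : ℕ) : ℝ)) : Prec (nodeAt m p i) (nodeAt m p j ++ [s]) := by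
  induction i using (wellFounded_coord_lt p).induction generalizing s with
  | _ i ih =>
  rcases nodeAt_eq_nil_or p i with hi | ⟨k, t, hk, hkt, hi⟩
  · rw [hi]
    simpa using prec_append [] (w := nodeAt m p j ++ [s]) (by simp)
  · rw [hi]
    by_cases ht : t = 0
    · subst ht
      refine (ih k hk hs (hk.trans h)).append_zero.resolve_left fun h' => ?_
      have := (List.append_inj' h' rfl).2
      simp only [List.cons.injEq, and_true] at this
      exact hs.ne this
    · exact append_prec_append_of_lt hs (Fin.pos_iff_ne_zero.2 ht) (by linarith)
        fun c hc h => ih k hk hc h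

theorem nodeAt_prec_append_iff {i j : Fin n} {s : Fin (m + 1)} (hs : 0 < s) :
    Prec (nodeAt m p i) (nodeAt m p j ++ [s]) ↔ p i < p j + ((s : ℕ) : ℝ) := by
  refine ⟨fun h => ?_, nodeAt_prec_append hs⟩
  by_contra h'
  exact not_prec.2 (append_precEq_nodeAt hs (not_lt.1 h')) h

/-- If a coordinate differs from an earlier one by a positive integer `≤ m`, then it differs
from the one at its parent by its rank. -/
theorem exists_parent_of_eq {i j : Fin n} {s : Fin (m + 1)} (hs : 0 < s)
    (h : p i = p j + ((s : ℕ) : ℝ)) : ∃ (k : Fin n) (t : Fin (m + 1)), 0 < t ∧ t ≤ s ∧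
      nodeAt m p i = nodeAt m p k ++ [t] ∧ p i = p k + ((t : ℕ) : ℝ) := by
  have hle := append_precEq_nodeAt hs h.ge
  rcases nodeAt_eq_nil_or p i with hi | ⟨k, t, hk, hkt, hi⟩
  · rw [hi] at hle
    have := hle.antisymm (nil_precEq _)
    simp at this
  rw [hi] at hle
  by_cases ht : t = 0
  · subst ht
    have h1 := (nodeAt_prec_append (m := m) (i := k) hs (h ▸ hk)).append_zero.antisymm hle
    have := (List.append_inj' h1 rfl).2
    simp only [List.cons.injEq, and_true] at this
    exact absurd this hs.ne
  have ht := Fin.pos_iff_ne_zero.2 ht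
  have heq : p i = p k + ((t : ℕ) : ℝ) := by
    by_contra hne
    -- With strict inequality, the slot chosen for `i` would precede the slot of `j` of value `p i`,
    -- contradicting maximality.
    refine not_prec.2 hle (append_prec_append_of_lt hs ht ?_ fun c hc h => nodeAt_prec_append hc h)
    rw [← h]
    exact lt_of_le_of_ne hkt (Ne.symm hne)
  refine ⟨k, t, ht, not_lt.1 fun hst => ?_, hi, heq⟩
  have hst' : (s : ℕ) < t := hst
  let c : Fin (m + 1) := ⟨t - s, by omega⟩
  have hc : (t : ℕ) = c + s := (Nat.sub_add_cancel hst'.le).symm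
  have hc0 : 0 < (c : ℕ) := by omega
  refine not_prec.2 hle (PrecEq.append_singleton_of_add hs hc (append_precEq_nodeAt hc0 ?_))
  rw [hc] at heq
  push_cast at heq
  linarith

variable (m p)

open Classical in
/-- The decorated tree of a point. -/
noncomputable def treeOfPoint : DecoratedTree m n where
  nodes := Finset.univ.image (nodeAt m p)
  parent_mem v c h := by
    simp only [Finset.mem_image, Finset.mem_univ, true_and] at h ⊢
    obtain ⟨i, hi⟩ := h
    rcases nodeAt_eq_nil_or (m := m) p i with hi' | ⟨k, t, -, -, hi'⟩
    · simp [hi] at hi'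
    · exact ⟨k, (List.append_inj' (hi'.symm.trans hi) rfl).1⟩
  label v := Finset.univ.filter fun i => nodeAt m p i = v
  label_nonempty v h := by
    simp only [Finset.mem_image, Finset.mem_univ, true_and] at h
    obtain ⟨i, hi⟩ := h
    exact ⟨i, by simpa using hi⟩
  label_eq_empty v h := by
    ext i
    simp only [Finset.mem_image, Finset.mem_univ, true_and, not_exists] at h
    simpa using h i
  label_partition i := ⟨nodeAt m p i, by simp, fun v h => by simpa [eq_comm] using h⟩
  dashed := (Finset.univ.image (nodeAt m p)).filter fun v => ∃ (i j : Fin n) (s : Fin (m + 1)),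
    0 < s ∧ v = nodeAt m p i ∧ nodeAt m p i = nodeAt m p j ++ [s] ∧ p i = p j + ((s : ℕ) : ℝ)
  dashed_cadet v h := by
    rw [Finset.mem_filter] at h
    obtain ⟨-, i, j, s, hs, rfl, hi, hp⟩ := h
    refine ⟨_, s, hi, hs, ?_, fun e he => ?_⟩
    · exact Finset.mem_image.2 ⟨i, Finset.mem_univ _, hi⟩
    -- If the child of rank `e > s` were the node of some `l`, then `p l ≥ p i + (e - s)`, placing
    -- the slot of rank `e - s` of `i` not later than `l`. But these have equal weight and the
    -- search meets `l` first.
    · simp only [Finset.mem_image, Finset.mem_univ, true_and, not_exists]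
      intro l hl
      have he' : (s : ℕ) < e := he
      have h1 : p j + ((e : ℕ) : ℝ) ≤ p l := by
        rw [← not_lt, ← nodeAt_prec_append_iff (m := m) (hs.trans he), hl]
        exact prec_irrefl _
      let c : Fin (m + 1) := ⟨e - s, by omega⟩
      have hc : (e : ℕ) = c + s := (Nat.sub_add_cancel he'.le).symm
      have hc0 : 0 < (c : ℕ) := by omega
      have h2 : PrecEq (nodeAt m p i ++ [c]) (nodeAt m p l) := by
        refine append_precEq_nodeAt hc0 ?_
        rw [hp]
        rw [hc] at h1
        push_cast at h1
        linarith
      refine not_prec.2 h2 ?_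
      rw [hl, hi, prec_iff]
      exact .inr ⟨by simp; omega, by simp [he]⟩

theorem nodeOf_treeOfPoint (i : Fin n) : (treeOfPoint m p).nodeOf i = nodeAt m p i := by
  rw [← DecoratedTree.mem_label_iff]
  simp [treeOfPoint]

variable {m p} in
theorem mem_dashed_treeOfPoint {v : Word m} : v ∈ (treeOfPoint m p).dashed ↔
    ∃ (i j : Fin n) (s : Fin (m + 1)), 0 < s ∧ v = nodeAt m p i ∧
      nodeAt m p i = nodeAt m p j ++ [s] ∧ p i = p j + ((s : ℕ) : ℝ) := by
  simp only [treeOfPoint, Finset.mem_filter, Finset.mem_image, Finset.mem_univ, true_and,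
    and_iff_right_iff_imp]
  rintro ⟨i, j, s, -, rfl, -⟩
  exact ⟨i, rfl⟩

variable {m p} in
theorem coord_sub_of_dashedPath {v w : Word m} (h : (treeOfPoint m p).DashedPath v w) {i j : Fin n}
    (hv : v = nodeAt m p j) (hw : w = nodeAt m p i) :
    p i - p j = (weight w : ℝ) - weight v := by
  induction h generalizing i with
  | refl =>
    rw [nodeAt_inj.1 (hw.symm.trans hv)]
    simp
  | tail _ h ih =>
    obtain ⟨⟨c, hc⟩, h⟩ := h
    obtain ⟨i', k, s, hs, rfl, hi, hp⟩ := mem_dashed_treeOfPoint.1 h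
    rw [hi] at hc
    have := ih (i := k) (List.append_inj' hc rfl).1.symm
    rw [← (List.append_inj' hc rfl).1] at this
    rw [← nodeAt_inj.1 hw, hp, hi]
    simp only [weight_append, weight_cons, weight_nil]
    push_cast
    linarith

variable {m p} in
-- The last edge into `i` is dashed, of some rank `t ≤ s`; its lower end is at distance `s - t` from
-- `p j`, and strong induction finishes.
theorem dashedPath_treeOfPoint {i j : Fin n} {s : Fin (m + 1)} (hs : 0 < s)
    (h : p i = p j + ((s : ℕ) : ℝ)) :
    (treeOfPoint m p).DashedPath (nodeAt m p j) (nodeAt m p i) := by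
  induction hk : (s : ℕ) using Nat.strong_induction_on generalizing i s with
  | _ d ih =>
  obtain ⟨k, t, ht, hts, hi, hik⟩ := exists_parent_of_eq (m := m) hs h
  have hstep : (treeOfPoint m p).DashedPath (nodeAt m p k) (nodeAt m p i) :=
    .single ⟨⟨t, hi⟩, mem_dashed_treeOfPoint.2 ⟨i, k, t, ht, rfl, hi, hik⟩⟩
  rcases hts.eq_or_lt with rfl | hts
  · rwa [nodeAt_congr (show p k = p j by linarith)] at hstep
  · have hts' : (t : ℕ) < s := hts
    have ht' : 0 < (t : ℕ) := ht
    let c : Fin (m + 1) := ⟨s - t, by omega⟩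
    have hc : (s : ℕ) = c + t := (Nat.sub_add_cancel hts'.le).symm
    have hc0 : 0 < (c : ℕ) := by omega
    refine Relation.ReflTransGen.trans (ih c (by omega) (i := k) hc0 ?_ rfl) hstep
    rw [hc] at h
    push_cast at h
    linarith

theorem valid_treeOfPoint : (treeOfPoint m p).Valid p := by
  rw [DecoratedTree.valid_iff]
  simp only [DecoratedTree.childOf, nodeOf_treeOfPoint]
  refine ⟨fun i j => nodeAt_precEq_iff.symm, fun i j s hs => (nodeAt_prec_append_iff hs).symm,
    fun i j s hs => ⟨fun h => ?_, fun ⟨h, h'⟩ => ?_⟩⟩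
  · have hpath := dashedPath_treeOfPoint hs h
    have := coord_sub_of_dashedPath hpath rfl rfl
    refine ⟨?_, hpath⟩
    rw [h] at this
    have : ((weight (nodeAt m p i) : ℕ) : ℝ) = ((weight (nodeAt m p j) + s : ℕ) : ℝ) := by
      push_cast
      linarith
    exact_mod_cast this
  · have := coord_sub_of_dashedPath h' rfl rfl
    rw [h] at this
    push_cast at this
    linarith

end TreeOfPoint

/-! ### The face of a tree -/

namespace DecoratedTree

variable {m n : ℕ} {T : DecoratedTree m n} {p q : Fin n → ℝ}

theorem sign_eq_sign_iff_of_real (x y : ℝ) :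
    SignType.sign x = SignType.sign y ↔ (x < 0 ↔ y < 0) ∧ (x = 0 ↔ y = 0) := by
  rcases lt_trichotomy x 0 with hx | rfl | hx <;> rcases lt_trichotomy y 0 with hy | rfl | hy <;>
    simp [*, sign_neg, sign_pos, not_lt_of_gt, ne_of_lt, ne_of_gt]

theorem Valid.arrangement_lt_iff (h : T.Valid p) (i j : Fin n) (s : Fin (m + 1)) :
    mCatalanArrangement m n (i, j, s) p < 0 ↔
      Prec (T.nodeOf i) (if s = 0 then T.nodeOf j else T.childOf j s) := by
  rw [mCatalanArrangement, sub_sub, sub_neg]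
  split_ifs with hs
  · simp [hs, h.coord_lt_iff]
  · exact h.lt_iff i j s (Fin.pos_iff_ne_zero.2 hs)

theorem Valid.arrangement_eq_iff (h : T.Valid p) (i j : Fin n) (s : Fin (m + 1)) :
    mCatalanArrangement m n (i, j, s) p = 0 ↔
      weight (T.nodeOf i) = weight (T.nodeOf j) + s ∧ T.DashedPath (T.nodeOf j) (T.nodeOf i) := by
  rw [mCatalanArrangement, sub_sub, sub_eq_zero]
  by_cases hs : s = 0
  · subst hs
    simp only [Fin.val_zero, Nat.cast_zero, add_zero]
    rw [le_antisymm_iff, h.le_iff, h.le_iff]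
    constructor
    · rintro ⟨h1, h2⟩
      rw [h1.antisymm h2]
      exact ⟨rfl, .refl⟩
    · rintro ⟨h1, h2⟩
      rcases h2.eq_or_weight_lt with h2 | h2
      · rw [h2]
        exact ⟨.refl _, .refl _⟩
      · omega
  · exact (valid_iff.1 h).2.2 i j s (Fin.pos_iff_ne_zero.2 hs)

/-- For a valid point the tree alone determines all signs; conversely, each of the three conditions
depends on the point only through signs. -/
theorem Valid.iff_sign (h : T.Valid p) : T.Valid q ↔ ∀ a,
    SignType.sign (mCatalanArrangement m n a q) = SignType.sign (mCatalanArrangement m n a p) := by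
  constructor
  · rintro hq ⟨i, j, s⟩
    rw [sign_eq_sign_iff_of_real, h.arrangement_lt_iff, hq.arrangement_lt_iff,
      h.arrangement_eq_iff, hq.arrangement_eq_iff]
    exact ⟨Iff.rfl, Iff.rfl⟩
  · intro hs
    have hlt (i j : Fin n) (s : Fin (m + 1)) :
        q i < q j + ((s : ℕ) : ℝ) ↔ p i < p j + ((s : ℕ) : ℝ) := by
      simpa only [mCatalanArrangement, sub_sub, sub_neg] using
        ((sign_eq_sign_iff_of_real _ _).1 (hs (i, j, s))).1
    have heq (i j : Fin n) (s : Fin (m + 1)) :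
        q i = q j + ((s : ℕ) : ℝ) ↔ p i = p j + ((s : ℕ) : ℝ) := by
      simpa only [mCatalanArrangement, sub_sub, sub_eq_zero] using
        ((sign_eq_sign_iff_of_real _ _).1 (hs (i, j, s))).2
    refine ⟨fun i j => ?_, fun i j s h0 => (hlt i j s).trans (h.lt_iff i j s h0),
      fun i j s h0 => (heq i j s).trans (h.eq_iff i j s h0)⟩
    rw [← h.le_iff, ← not_lt, ← not_lt, not_iff_not]
    simpa using hlt j i 0

/-- The face of a decorated tree. -/
def face (T : DecoratedTree m n) : MCatalanFace m n :=
  ⟨{p | T.Valid p}, ⟨T.point, T.valid_point⟩,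
    fun a => SignType.sign (mCatalanArrangement m n a T.point),
    Set.ext fun _ => T.valid_point.iff_sign⟩

theorem mem_face : p ∈ T.face.1 ↔ T.Valid p := Iff.rfl

/-- Injectivity: a common point recovers the tree. Surjectivity: any point of the given face
supplies a tree, and both sets are the points sharing its signs. -/
theorem face_bijective : Function.Bijective (face (m := m) (n := n)) := by
  constructor
  · intro T T' h
    have hp : T.point ∈ T'.face.1 := h ▸ T.valid_point
    exact T.valid_point.unique hp
  · rintro ⟨F, ⟨p, hp⟩, σ, rfl⟩
    refine ⟨treeOfPoint m p, Subtype.ext (Set.ext fun q => ?_)⟩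
    rw [mem_face, (valid_treeOfPoint m p).iff_sign]
    exact forall_congr' fun a => by rw [hp a]

/-! ### The dimension of the face of a tree -/

theorem exists_free_dashedPath {v : Word m} (hv : v ∈ T.nodes) :
    ∃ u ∈ T.freeNodes, T.DashedPath u v := by
  induction v using List.reverseRecOn with
  | nil =>
    refine ⟨[], Finset.mem_filter.2 ⟨hv, fun h => ?_⟩, .refl⟩
    obtain ⟨u, c, h, -⟩ := T.dashed_cadet _ h
    simp at h
  | append_singleton v c ih =>
    by_cases hd : v ++ [c] ∈ T.dashed
    · obtain ⟨u, hu, h⟩ := ih (T.parent_mem _ _ hv)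
      exact ⟨u, hu, h.tail ⟨⟨c, rfl⟩, hd⟩⟩
    · exact ⟨_, Finset.mem_filter.2 ⟨hv, hd⟩, .refl⟩

theorem DashedPath.eq_of_mem_freeNodes {u v : Word m} (h : T.DashedPath u v)
    (hv : v ∈ T.freeNodes) : u = v := by
  rcases Relation.ReflTransGen.cases_tail h with h | ⟨w, -, h⟩
  · exact h.symm
  · exact absurd h.2 (Finset.mem_filter.1 hv).2

theorem DashedPath.free_unique {u u' v : Word m} (h : T.DashedPath u v) (h' : T.DashedPath u' v)
    (hu : u ∈ T.freeNodes) (hu' : u' ∈ T.freeNodes) : u = u' := by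
  induction h with
  | refl => exact (h'.eq_of_mem_freeNodes hu).symm
  | tail hp hs ih =>
    obtain ⟨⟨c, rfl⟩, hd⟩ := hs
    rcases Relation.ReflTransGen.cases_tail h' with h | ⟨w, hw, ⟨c', h⟩, -⟩
    · rw [h] at hd
      exact absurd hd (Finset.mem_filter.1 hu').2
    · rw [← (List.append_inj' h rfl).1] at hw
      exact ih hw

/-- The free node from which a dashed path leads to the node of `i`. -/
noncomputable def freeRoot (T : DecoratedTree m n) (i : Fin n) : T.freeNodes :=
  ⟨_, (exists_free_dashedPath (T.nodeOf_mem i)).choose_spec.1⟩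

theorem dashedPath_freeRoot (i : Fin n) : T.DashedPath (T.freeRoot i) (T.nodeOf i) :=
  (exists_free_dashedPath (T.nodeOf_mem i)).choose_spec.2

theorem DashedPath.freeRoot_eq {i j : Fin n} (h : T.DashedPath (T.nodeOf j) (T.nodeOf i)) :
    T.freeRoot i = T.freeRoot j :=
  Subtype.ext <| (dashedPath_freeRoot i).free_unique
    (Relation.ReflTransGen.trans (dashedPath_freeRoot j) h) (T.freeRoot i).2 (T.freeRoot j).2

theorem exists_nodeOf_eq_freeNode (u : T.freeNodes) : ∃ i, T.nodeOf i = u :=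
  T.exists_nodeOf_eq (Finset.mem_filter.1 u.2).1

theorem freeRoot_surjective : Function.Surjective T.freeRoot := by
  intro u
  obtain ⟨i, hi⟩ := exists_nodeOf_eq_freeNode u
  have h := dashedPath_freeRoot (T := T) i
  rw [hi] at h
  exact ⟨i, Subtype.ext (h.eq_of_mem_freeNodes u.2)⟩

theorem Valid.coord_sub_of_dashedPath (h : T.Valid p) {v w : Word m} (hp : T.DashedPath v w)
    {i j : Fin n} (hi : T.nodeOf i = w) (hj : T.nodeOf j = v) :
    p i - p j = (weight w : ℝ) - weight v := by
  induction hp generalizing i with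
  | refl =>
    have h1 := (h.le_iff i j).2 (.inl (hi.trans hj.symm))
    have h2 := (h.le_iff j i).2 (.inl (hj.trans hi.symm))
    linarith
  | tail _ hs ih =>
    obtain ⟨⟨c, rfl⟩, hd⟩ := hs
    have hc := isCadet_of_dashed hd
    obtain ⟨k, hk⟩ := T.exists_nodeOf_eq (T.parent_mem _ _ hc.2.1)
    have hik := ((valid_iff.1 h).2.2 i k c hc.1).2
      ⟨by simp [hi, hk], by rw [hi, hk]; exact .single ⟨⟨c, rfl⟩, hd⟩⟩
    have := ih hk
    simp only [weight_append, weight_cons, weight_nil]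
    push_cast
    linarith

open Filter Topology in
/-- A point in the face of a tree can be moved in each direction that is constant on the
coordinates whose nodes are connected by dashed paths. -/
theorem Valid.exists_perturbation (h : T.Valid p) (g : T.freeNodes → ℝ) :
    ∃ ε : ℝ, 0 < ε ∧ T.Valid (p + ε • (g ∘ T.freeRoot)) := by
  have hev : ∀ᶠ ε : ℝ in 𝓝 0, ∀ a,
      SignType.sign (mCatalanArrangement m n a (p + ε • (g ∘ T.freeRoot))) =
        SignType.sign (mCatalanArrangement m n a p) := by
    rw [eventually_all]
    rintro ⟨i, j, s⟩
    have hcont : Continuous fun ε : ℝ =>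
        mCatalanArrangement m n (i, j, s) (p + ε • (g ∘ T.freeRoot)) := by
      simp only [mCatalanArrangement, Pi.add_apply, Pi.smul_apply, smul_eq_mul]
      fun_prop
    have h0 : mCatalanArrangement m n (i, j, s) (p + (0 : ℝ) • (g ∘ T.freeRoot)) =
        mCatalanArrangement m n (i, j, s) p := by simp
    have ht := hcont.tendsto 0
    rw [h0] at ht
    rcases lt_trichotomy (mCatalanArrangement m n (i, j, s) p) 0 with hs | hs | hs
    · filter_upwards [ht.eventually_lt_const hs] with ε hε
      rw [sign_neg hε, sign_neg hs]
    -- A hyperplane through `p` relates coordinates of the same chain, which move together.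
    · have hr := ((h.arrangement_eq_iff i j s).1 hs).2.freeRoot_eq
      refine .of_forall fun ε => congrArg _ ?_
      simp only [mCatalanArrangement, Pi.add_apply, Pi.smul_apply, Function.comp_apply, hr]
      ring
    · filter_upwards [ht.eventually_const_lt hs] with ε hε
      rw [sign_pos hε, sign_pos hs]
  obtain ⟨ε, hε, hpos⟩ := ((hev.filter_mono nhdsWithin_le_nhds).and
    (self_mem_nhdsWithin (s := Set.Ioi (0 : ℝ)))).exists
  exact ⟨ε, hpos, h.iff_sign.2 hε⟩

/-- Two valid points differ by a vector constant on each chain, since differences within a chain are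
differences of weights. Perturbing `T.point` realizes every such vector up to scale. -/
theorem direction_affineSpan_face (T : DecoratedTree m n) :
    (affineSpan ℝ T.face.1).direction = LinearMap.range (LinearMap.funLeft ℝ ℝ T.freeRoot) := by
  rw [direction_affineSpan]
  apply le_antisymm
  · rw [vectorSpan_def, Submodule.span_le]
    rintro _ ⟨p, hp, q, hq, rfl⟩
    choose k hk using exists_nodeOf_eq_freeNode (T := T)
    refine ⟨fun u => p (k u) - q (k u), funext fun i => ?_⟩
    have hpath := dashedPath_freeRoot (T := T) i
    have h1 := Valid.coord_sub_of_dashedPath hp hpath rfl (hk _)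
    have h2 := Valid.coord_sub_of_dashedPath hq hpath rfl (hk _)
    simp only [LinearMap.funLeft_apply, vsub_eq_sub, Pi.sub_apply]
    linarith
  · rintro _ ⟨g, rfl⟩
    obtain ⟨ε, hε, hv⟩ := T.valid_point.exists_perturbation g
    have := vsub_mem_vectorSpan ℝ (s := T.face.1) hv T.valid_point
    rw [vsub_eq_sub, add_sub_cancel_left, Submodule.smul_mem_iff _ hε.ne'] at this
    exact this

theorem faceDim_face (T : DecoratedTree m n) : faceDim T.face.1 = T.freeNodes.card := by
  rw [faceDim, direction_affineSpan_face, LinearMap.finrank_range_of_inj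
    (LinearMap.funLeft_injective_of_surjective ℝ ℝ _ freeRoot_surjective)]
  simp

end DecoratedTree

end MCatalan

theorem mainTheorem1 (m n : ℕ) (hm : 1 ≤ m) :
    (∀ T : MCatalan.DecoratedTree m n,
      ∃! F : MCatalan.MCatalanFace m n, ∀ p : Fin n → ℝ, p ∈ F.1 ↔ T.Valid p) ∧
    ∃ Φ : MCatalan.DecoratedTree m n → MCatalan.MCatalanFace m n,
      (∀ (T : MCatalan.DecoratedTree m n) (p : Fin n → ℝ), p ∈ (Φ T).1 ↔ T.Valid p) ∧
      Function.Bijective Φ ∧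
      ∀ (T : MCatalan.DecoratedTree m n) (k : ℕ),
        T.freeNodes.card = k ↔ MCatalan.faceDim (Φ T).1 = k := by
  refine ⟨fun T => ⟨T.face, fun p => Iff.rfl, fun F hF => Subtype.ext (Set.ext hF)⟩,
    MCatalan.DecoratedTree.face, fun T p => Iff.rfl, MCatalan.DecoratedTree.face_bijective,
    fun T k => ?_⟩
  rw [T.faceDim_face]
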